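/- Let $d\ge 1$ and let $\mathbf X$ be a random vector in $\mathbb R^d$ with finite second moments, mean $\boldsymbol\mu$ and full-rank (positive definite) covariance matrix $\boldsymbol\Sigma$, and suppose that $\mathbf X$ is elliptical, i.e. its characteristic function has the form $\mathbb E\,e^{i\mathbf t'\mathbf X}=e^{i\mathbf t'\boldsymbol\mu}\,\phi(\mathbf t'\boldsymbol\Sigma\mathbf t)$, $\mathbf t\in\mathbb R^d$, for some scalar function $\phi$. Let $\lambda_1\ge\cdots\ge\lambda_d$ be the eigenvalues of $\boldsymbol\Sigma$, with corresponding orthonormal eigenvectors $v_1,\dots,v_d$, let $\mathbf V=(v_1,\dots,v_d)$ be the matrix with these columns, and let $\mathbf Y=(Y_1,\dots,Y_d)'=\mathbf V'\mathbf X$. For $\alpha\in[0,1]$ let $$\mathsf T_{Y_i}^\alpha=\bigl[\,Q_{Y_i}(\alpha/2),\,Q_{Y_i}(1-\alpha/2)\,\bigr],\qquad Q_{Y_i}(p)=\inf\{x\in\mathbb R:\ \mathbb P(Y_i\le x)\ge p\}\in[-\infty,\infty],$$ be the central $(1-\alpha)$-inter-quantile interval of $Y_i$ (as a set of real numbers),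 and let $$\tau_i=\operatorname{Tr}\Bigl(\operatorname{Cov}\bigl(\mathbf Y\,\big|\,Y_i\in\mathsf T_{Y_i}^\alpha\bigr)\Bigr)$$ be the preserved total variance after truncating only the coordinate $Y_i$. Then $\mathbb P(Y_i\in\mathsf T_{Y_i}^\alpha)\ge 1-\alpha$ for every $i$, so that $\tau_i$ is well defined whenever $\alpha<1$ (if $\alpha=1$ and the conditioning event is null, $\tau_i$ is taken to be $0$), and: 1. the preserved total variance is nonincreasing in the eigenvalue: for all $i,j$, if $\lambda_i\le\lambda_j$ then $\tau_j\le\tau_i$; 2. consequently, for every $i$, $\tau_1\le\tau_i\le\tau_d$; that is, it is maximized by peeling $Y_d$ and minimized by peeling $Y_1$. -/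

import Mathlib

open MeasureTheory ProbabilityTheory
open scoped Matrix

noncomputable section

namespace Peeling

/-- The covariance matrix `(Cov(Z_i, Z_j))_{i,j}` of a random vector `Z` under the measure `P`. -/
def covMatrix {Ω : Type*} [MeasurableSpace Ω] {d : ℕ}
    (Z : Ω → EuclideanSpace ℝ (Fin d)) (P : Measure Ω) : Matrix (Fin d) (Fin d) ℝ :=
  Matrix.of fun i j => cov[fun ω => Z ω i, fun ω => Z ω j; P]

/-- `X` is an elliptical random vector with mean `m` and full-rank covariance matrix `S`:
its characteristic function is `t ↦ exp(i ⟨t, m⟩) φ(tᵀ S t)` for some scalar function `φ`. -/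
structure IsElliptical {Ω : Type*} [MeasurableSpace Ω] {d : ℕ}
    (X : Ω → EuclideanSpace ℝ (Fin d)) (P : Measure Ω)
    (m : EuclideanSpace ℝ (Fin d)) (S : Matrix (Fin d) (Fin d) ℝ) : Prop where
  measurable : Measurable X
  memLp : MemLp X 2 P
  mean_eq : ∫ ω, X ω ∂P = m
  cov_eq : covMatrix X P = S
  posDef : S.PosDef
  charFun_eq : ∃ φ : ℝ → ℂ, ∀ t : EuclideanSpace ℝ (Fin d),
    charFun (P.map X) t
      = Complex.exp (Complex.I * ((inner ℝ t m : ℝ) : ℂ)) * φ (t.ofLp ⬝ᵥ (S *ᵥ t.ofLp))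

/-- The `p`-quantile `inf {x : ℝ | p ≤ F(x)}` of a law on the line with distribution function `F`.
It is extended-real-valued, so that the `0`-quantile is `-∞` and the `1`-quantile may be `+∞`. -/
def quantile (ν : Measure ℝ) (p : ℝ) : EReal :=
  sInf ((fun x : ℝ => (x : EReal)) '' {x : ℝ | p ≤ cdf ν x})

/-- The central `(1 - α)`-inter-quantile interval `[Q(α/2), Q(1 - α/2)]`, as a set of reals. -/
def centralInterval (ν : Measure ℝ) (α : ℝ) : Set ℝ :=
  {y : ℝ | quantile ν (α / 2) ≤ (y : EReal) ∧ (y : EReal) ≤ quantile ν (1 - α / 2)}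

/-- The matrix `V = (v₁, …, v_d)` with columns `v_j`. -/
def columnMatrix {d : ℕ} (v : Fin d → EuclideanSpace ℝ (Fin d)) : Matrix (Fin d) (Fin d) ℝ :=
  Matrix.of fun i j => v j i

/-- The rotated vector `Y = Vᵀ X`. -/
def rotate {Ω : Type*} {d : ℕ} (v : Fin d → EuclideanSpace ℝ (Fin d))
    (X : Ω → EuclideanSpace ℝ (Fin d)) : Ω → EuclideanSpace ℝ (Fin d) :=
  fun ω => WithLp.toLp 2 ((columnMatrix v)ᵀ *ᵥ (X ω).ofLp)

/-- The event that the `i`-th coordinate of `Y` lies in its central `(1 - α)`-inter-quantile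
interval. -/
def peelEvent {Ω : Type*} [MeasurableSpace Ω] {d : ℕ}
    (Y : Ω → EuclideanSpace ℝ (Fin d)) (P : Measure Ω) (α : ℝ) (i : Fin d) : Set Ω :=
  {ω | Y ω i ∈ centralInterval (P.map fun ω' => Y ω' i) α}

/-- The preserved total variance: the trace of the covariance matrix of `Y` conditional on the
event that `Y_i` lies in its central `(1 - α)`-inter-quantile interval. -/
def preservedTotalVariance {Ω : Type*} [MeasurableSpace Ω] {d : ℕ}
    (Y : Ω → EuclideanSpace ℝ (Fin d)) (P : Measure Ω) (α : ℝ) (i : Fin d) : ℝ :=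
  (covMatrix Y (P[|peelEvent Y P α i])).trace

end Peeling

end

/-
The standardized principal components `Z` have a radial characteristic function, so their law is
invariant under exchanging two coordinates and under changing the sign of one. As `Y k` is an
increasing affine function of `Z k`, peeling `Y i` conditions on `Z i ∈ T`, where `T`, the central
interval of the common symmetric law of the coordinates, contains `0` or has at most one point.
The symmetrized indicator `1_T(z) + 1_T(-z)` decreases with `|z|`, so Chebyshev's argument gives
`E[Z i ^ 2 | Z i ∈ T] ≤ E[Z j ^ 2 | Z i ∈ T]`; as `Z j` stays centered under the conditioning, `Z i`
has the smallest conditional variance. Conditioning on `Z j ∈ T` instead merely exchanges two of the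
conditional variances `w k`, so the rearrangement inequality compares the two preserved total
variances, both of the form `∑ k, lam k * w k`.
-/

namespace Peeling

section CentralInterval

variable {ν : Measure ℝ} {α : ℝ}

theorem quantile_le_coe_iff (ν : Measure ℝ) (p y : ℝ) :
    quantile ν p ≤ (y : EReal) ↔ p ≤ cdf ν y := by
  refine ⟨fun h => ?_, fun h => sInf_le ⟨y, h, rfl⟩⟩
  have le_cdf_of_lt : ∀ z ∈ Set.Ioi y, p ≤ cdf ν z := by
    intro z hyz
    obtain ⟨_, ⟨x, hpx, rfl⟩, hxz⟩ :=
      sInf_lt_iff.1 (lt_of_le_of_lt h (EReal.coe_lt_coe_iff.2 hyz))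
    exact le_trans hpx (monotone_cdf ν (EReal.coe_lt_coe_iff.1 hxz).le)
  have right_continuous : ContinuousWithinAt (cdf ν) (Set.Ioi y) y :=
    ((cdf ν).right_continuous y).mono Set.Ioi_subset_Ici_self
  exact ge_of_tendsto right_continuous (Filter.eventually_of_mem self_mem_nhdsWithin le_cdf_of_lt)

theorem coe_le_quantile_iff (ν : Measure ℝ) (p y : ℝ) :
    (y : EReal) ≤ quantile ν p ↔ ∀ x < y, cdf ν x < p := by
  simp only [quantile, le_sInf_iff, Set.forall_mem_image, Set.mem_ofPred_eq, EReal.coe_le_coe_iff]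
  exact forall_congr' fun x => by rw [← not_imp_not, not_le, not_le]

theorem mem_centralInterval_iff {y : ℝ} :
    y ∈ centralInterval ν α ↔ α / 2 ≤ cdf ν y ∧ ∀ x < y, cdf ν x < 1 - α / 2 :=
  and_congr (quantile_le_coe_iff ν _ y) (coe_le_quantile_iff ν _ y)

theorem ordConnected_centralInterval (ν : Measure ℝ) (α : ℝ) :
    (centralInterval ν α).OrdConnected := by
  refine ⟨fun x hx y hy z hz => ?_⟩
  rw [mem_centralInterval_iff] at *
  exact ⟨hx.1.trans (monotone_cdf ν hz.1), fun w hw => hy.2 w (hw.trans_le hz.2)⟩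

theorem measurableSet_centralInterval (ν : Measure ℝ) (α : ℝ) :
    MeasurableSet (centralInterval ν α) :=
  (ordConnected_centralInterval ν α).measurableSet

theorem subsingleton_centralInterval (ν : Measure ℝ) (hα : 1 ≤ α) :
    (centralInterval ν α).Subsingleton := by
  have not_lt_of_mem : ∀ x ∈ centralInterval ν α, ∀ y ∈ centralInterval ν α, ¬x < y := by
    intro x hx y hy hxy
    linarith [(mem_centralInterval_iff.1 hx).1, (mem_centralInterval_iff.1 hy).2 x hxy]
  exact fun x hx y hy =>
    le_antisymm (not_lt.1 (not_lt_of_mem y hy x hx)) (not_lt.1 (not_lt_of_mem x hx y hy))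

variable [IsProbabilityMeasure ν]

theorem cdf_map_mul_add {s : ℝ} (hs : 0 < s) (c x : ℝ) :
    cdf (ν.map fun z => s * z + c) (s * x + c) = cdf ν x := by
  have hm : Measurable fun z : ℝ => s * z + c := by fun_prop
  have := Measure.isProbabilityMeasure_map (μ := ν) hm.aemeasurable
  have preimage_Iic : (fun z => s * z + c) ⁻¹' Set.Iic (s * x + c) = Set.Iic x := by
    ext z
    simp [hs]
  rw [cdf_eq_real, cdf_eq_real, map_measureReal_apply hm measurableSet_Iic, preimage_Iic]

theorem mul_add_mem_centralInterval_map_iff {s : ℝ} (hs : 0 < s) (c y : ℝ) :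
    s * y + c ∈ centralInterval (ν.map fun z => s * z + c) α ↔ y ∈ centralInterval ν α := by
  have surj : Function.Surjective fun x : ℝ => s * x + c :=
    fun w => ⟨(w - c) / s, by field_simp; ring⟩
  rw [mem_centralInterval_iff, mem_centralInterval_iff, surj.forall]
  simp only [cdf_map_mul_add hs, add_lt_add_iff_right, mul_lt_mul_iff_right₀ hs]

/- In the next two lemmas `p` may lie in a jump of the distribution function; inner regularity
reduces to a compact set, whose extreme element witnesses the bound. -/
theorem measure_setOf_cdf_lt_le (ν : Measure ℝ) [IsProbabilityMeasure ν] (p : ℝ) :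
    ν {y | cdf ν y < p} ≤ ENNReal.ofReal p := by
  have hmeas : MeasurableSet {y | cdf ν y < p} := (monotone_cdf ν).measurable measurableSet_Iio
  rw [hmeas.measure_eq_iSup_isCompact]
  refine iSup_le fun K => iSup_le fun hK => iSup_le fun hc => ?_
  rcases K.eq_empty_or_nonempty with rfl | hne
  · simp
  have cdf_sSup_lt : cdf ν (sSup K) < p := hK (hc.sSup_mem hne)
  calc ν K ≤ ν (Set.Iic (sSup K)) := measure_mono fun x hx => le_csSup hc.bddAbove hx
    _ = ENNReal.ofReal (cdf ν (sSup K)) := (ofReal_cdf ν _).symm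
    _ ≤ ENNReal.ofReal p := ENNReal.ofReal_le_ofReal cdf_sSup_lt.le

theorem measure_setOf_exists_lt_le_cdf_le (ν : Measure ℝ) [IsProbabilityMeasure ν] (p : ℝ) :
    ν {y | ∃ x < y, p ≤ cdf ν x} ≤ ENNReal.ofReal (1 - p) := by
  have hconn : {y | ∃ x < y, p ≤ cdf ν x}.OrdConnected :=
    ⟨fun _ ⟨w, hw, hp⟩ _ _ _ hz => ⟨w, hw.trans_le hz.1, hp⟩⟩
  rw [hconn.measurableSet.measure_eq_iSup_isCompact]
  refine iSup_le fun K => iSup_le fun hK => iSup_le fun hc => ?_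
  rcases K.eq_empty_or_nonempty with rfl | hne
  · simp
  obtain ⟨x, hx, hp⟩ := hK (hc.sInf_mem hne)
  calc ν K ≤ ν (Set.Iic x)ᶜ :=
        measure_mono fun z hz => not_le.2 (hx.trans_le (csInf_le hc.bddBelow hz))
    _ = ENNReal.ofReal (1 - cdf ν x) := by
      rw [prob_compl_eq_one_sub measurableSet_Iic, ← ofReal_cdf,
        ENNReal.ofReal_sub _ (cdf_nonneg ν x), ENNReal.ofReal_one]
    _ ≤ ENNReal.ofReal (1 - p) := ENNReal.ofReal_le_ofReal (by linarith)

theorem ofReal_one_sub_le_measure_centralInterval (ν : Measure ℝ) [IsProbabilityMeasure ν]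
    (hα : 0 ≤ α) : ENNReal.ofReal (1 - α) ≤ ν (centralInterval ν α) := by
  have compl_eq : (centralInterval ν α)ᶜ
      = {y | cdf ν y < α / 2} ∪ {y | ∃ x < y, 1 - α / 2 ≤ cdf ν x} := by
    ext y
    simp only [Set.mem_compl_iff, mem_centralInterval_iff, Set.mem_union, Set.mem_ofPred_eq,
      not_and_or]
    push Not
    rfl
  have measure_compl_le : ν (centralInterval ν α)ᶜ ≤ ENNReal.ofReal α := by
    calc ν (centralInterval ν α)ᶜ
        ≤ ν {y | cdf ν y < α / 2} + ν {y | ∃ x < y, 1 - α / 2 ≤ cdf ν x} :=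
          compl_eq ▸ measure_union_le _ _
      _ ≤ ENNReal.ofReal (α / 2) + ENNReal.ofReal (1 - (1 - α / 2)) :=
          add_le_add (measure_setOf_cdf_lt_le ν _) (measure_setOf_exists_lt_le_cdf_le ν _)
      _ = ENNReal.ofReal α := by
          rw [← ENNReal.ofReal_add (by linarith) (by linarith)]
          ring_nf
  rw [ENNReal.ofReal_sub _ hα, ENNReal.ofReal_one, tsub_le_iff_right,
    ← prob_add_prob_compl (μ := ν) (measurableSet_centralInterval ν α)]
  gcongr

theorem zero_mem_centralInterval (hν : ν.map (fun x => -x) = ν) (hα : α < 1) :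
    (0 : ℝ) ∈ centralInterval ν α := by
  have real_Ici_neg : ∀ x, ν.real (Set.Ici (-x)) = cdf ν x := by
    intro x
    conv_rhs => rw [cdf_eq_real, ← hν, map_measureReal_apply measurable_neg measurableSet_Iic]
    congr 1
    ext z
    simp
  have half_le_cdf_zero : 1 / 2 ≤ cdf ν 0 := by
    have h : (1 : ℝ) ≤ ν.real (Set.Iic 0) + ν.real (Set.Ici (-0)) := by
      rw [neg_zero, ← probReal_univ (μ := ν), ← Set.Iic_union_Ici (a := (0 : ℝ))]
      exact measureReal_union_le _ _
    rw [real_Ici_neg, ← cdf_eq_real] at h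
    linarith
  have cdf_le_half : ∀ x < 0, cdf ν x ≤ 1 / 2 := by
    intro x hx
    have hdisj : Disjoint (Set.Iic x) (Set.Ici (-x)) := Set.Iic_disjoint_Ici.2 (by linarith)
    have h := measureReal_union (μ := ν) hdisj measurableSet_Ici
    rw [real_Ici_neg, ← cdf_eq_real] at h
    linarith [measureReal_le_one (μ := ν) (s := Set.Iic x ∪ Set.Ici (-x))]
  exact mem_centralInterval_iff.2
    ⟨by linarith, fun x hx => (cdf_le_half x hx).trans_lt (by linarith)⟩

theorem zero_mem_or_subsingleton_centralInterval (hν : ν.map (fun x => -x) = ν) (α : ℝ) :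
    (0 : ℝ) ∈ centralInterval ν α ∨ (centralInterval ν α).Subsingleton :=
  (lt_or_ge α 1).imp (zero_mem_centralInterval hν) (subsingleton_centralInterval ν)

end CentralInterval

section Conditioning

variable {Ω Ω' : Type*} [MeasurableSpace Ω] [MeasurableSpace Ω'] {μ : Measure Ω} {ν : Measure Ω'}

theorem map_cond_preimage {f : Ω → Ω'} (hf : AEMeasurable f μ) {s : Set Ω'}
    (hs : MeasurableSet s) : (μ[|f ⁻¹' s]).map f = (μ.map f)[|s] := by
  simp only [ProbabilityTheory.cond, Measure.map_smul, Measure.restrict_map_of_aemeasurable hf hs,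
    Measure.map_apply_of_aemeasurable hf hs]

theorem measurePreserving_cond_preimage {f : Ω → Ω'} (hf : MeasurePreserving f μ ν) {s : Set Ω'}
    (hs : MeasurableSet s) : MeasurePreserving f (μ[|f ⁻¹' s]) (ν[|s]) :=
  ⟨hf.measurable, by rw [map_cond_preimage hf.aemeasurable hs, hf.map_eq]⟩

theorem variance_cond_preimage_eq_zero {f : Ω → ℝ} (hf : Measurable f) {T : Set ℝ}
    (hT : T.Subsingleton) : Var[f; μ[|f ⁻¹' T]] = 0 := by
  rcases T.eq_empty_or_nonempty with rfl | ⟨c, hc⟩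
  · simp
  have hconst : f =ᵐ[μ[|f ⁻¹' T]] fun _ => c := by
    filter_upwards [ae_cond_mem (hf hT.measurableSet)] with ω hω using hT hω hc
  rw [variance_congr hconst]
  by_cases hzero : μ[|f ⁻¹' T] = 0
  · simp [hzero]
  obtain ⟨hfin, hpos⟩ := not_or.1 (cond_eq_zero.not.1 hzero)
  have := cond_isProbabilityMeasure_of_finite hpos hfin
  simp [variance_eq_integral]

end Conditioning

section Hyperoctahedral

variable {ι : Type*} [Fintype ι] [DecidableEq ι]

/-- The linear isometry of Euclidean space exchanging the coordinates `i` and `j`. -/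
noncomputable def swapIsometry (i j : ι) : EuclideanSpace ℝ ι ≃ₗᵢ[ℝ] EuclideanSpace ℝ ι :=
  LinearIsometryEquiv.piLpCongrLeft 2 ℝ ℝ (Equiv.swap i j)

@[simp]
theorem swapIsometry_apply (i j k : ι) (z : EuclideanSpace ℝ ι) :
    swapIsometry i j z k = z (Equiv.swap i j k) := rfl

/-- The linear isometry of Euclidean space changing the sign of the coordinate `i`. -/
noncomputable def flipIsometry (i : ι) : EuclideanSpace ℝ ι ≃ₗᵢ[ℝ] EuclideanSpace ℝ ι :=
  LinearIsometryEquiv.piLpCongrRight 2 fun k =>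
    if k = i then LinearIsometryEquiv.neg ℝ else LinearIsometryEquiv.refl ℝ ℝ

@[simp]
theorem flipIsometry_apply_self (i : ι) (z : EuclideanSpace ℝ ι) :
    flipIsometry i z i = -z i := by
  simp [flipIsometry]

theorem flipIsometry_apply_of_ne {i k : ι} (h : k ≠ i) (z : EuclideanSpace ℝ ι) :
    flipIsometry i z k = z k := by
  simp [flipIsometry, h]

/-- A measure invariant under permutations and sign changes of the coordinates, that is, under
the hyperoctahedral group; invariance is required of the generators only. -/
structure IsHyperoctahedral (ρ : Measure (EuclideanSpace ℝ ι)) : Prop where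
  measurePreserving_swap : ∀ i j, MeasurePreserving (swapIsometry i j) ρ ρ
  measurePreserving_flip : ∀ i, MeasurePreserving (flipIsometry i) ρ ρ

theorem indicator_add_indicator_neg_le {T : Set ℝ} (hT : T.OrdConnected) (h0 : (0 : ℝ) ∈ T)
    {x y : ℝ} (hxy : |x| ≤ |y|) :
    T.indicator (1 : ℝ → ℝ) y + T.indicator 1 (-y)
      ≤ T.indicator (1 : ℝ → ℝ) x + T.indicator 1 (-x) := by
  have even : ∀ w : ℝ, T.indicator (1 : ℝ → ℝ) w + T.indicator 1 (-w)
      = T.indicator 1 |w| + T.indicator 1 (-|w|) := fun w => by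
    rcases abs_choice w with h | h <;> simp [h, add_comm]
  have indicator_le : ∀ {a b : ℝ}, (b ∈ T → a ∈ T) →
      T.indicator (1 : ℝ → ℝ) b ≤ T.indicator 1 a := fun {a b} h => by
    by_cases hb : b ∈ T
    · simp [hb, h hb]
    · simpa [hb] using Set.indicator_nonneg (by simp) a
  have hx := abs_nonneg x
  rw [even x, even y]
  exact add_le_add (indicator_le fun hy => hT.out h0 hy ⟨hx, hxy⟩)
    (indicator_le fun hy => hT.out hy h0 ⟨by linarith, by linarith⟩)

theorem sum_mul_le_sum_mul_swap {a w : ι → ℝ} {i j : ι} (ha : a i ≤ a j) (hw : w i ≤ w j) :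
    ∑ k, a k * w (Equiv.swap i j k) ≤ ∑ k, a k * w k := by
  rcases eq_or_ne i j with rfl | hij
  · simp
  rw [← sub_nonneg, ← Finset.sum_sub_distrib,
    Fintype.sum_eq_add i j hij fun k hk => by simp [Equiv.swap_apply_of_ne_of_ne hk.1 hk.2]]
  simp only [Equiv.swap_apply_left, Equiv.swap_apply_right]
  nlinarith [mul_nonneg (sub_nonneg.2 ha) (sub_nonneg.2 hw)]

namespace IsHyperoctahedral

variable {ρ : Measure (EuclideanSpace ℝ ι)} {T : Set ℝ} {i j : ι}

theorem map_coord_eq (hρ : IsHyperoctahedral ρ) (i j : ι) :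
    ρ.map (fun z => z i) = ρ.map (fun z => z j) := by
  have h := hρ.measurePreserving_swap i j
  conv_lhs => rw [← h.map_eq, Measure.map_map (by fun_prop) h.measurable]
  simp [Function.comp_def]

theorem map_neg_map_coord (hρ : IsHyperoctahedral ρ) (i : ι) :
    (ρ.map fun z => z i).map (fun x => -x) = ρ.map fun z => z i := by
  have h := hρ.measurePreserving_flip i
  conv_rhs => rw [← h.map_eq, Measure.map_map (by fun_prop) h.measurable]
  rw [Measure.map_map (by fun_prop) (by fun_prop)]
  simp [Function.comp_def]

theorem variance_cond_swap (hρ : IsHyperoctahedral ρ) (hT : MeasurableSet T) (i j k : ι) :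
    Var[fun z => z (Equiv.swap i j k); ρ[|{z | z i ∈ T}]]
      = Var[fun z => z k; ρ[|{z | z j ∈ T}]] := by
  have hB : MeasurableSet {z : EuclideanSpace ℝ ι | z j ∈ T} :=
    measurableSet_preimage (by fun_prop) hT
  have h := (measurePreserving_cond_preimage (hρ.measurePreserving_swap i j) hB).variance_fun_comp
    (f := fun z => z k) (by fun_prop)
  simpa using h

theorem integral_cond_eq_zero (hρ : IsHyperoctahedral ρ) (hT : MeasurableSet T) (hij : i ≠ j) :
    ∫ z, z j ∂(ρ[|{z | z i ∈ T}]) = 0 := by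
  have hB : MeasurableSet {z : EuclideanSpace ℝ ι | z i ∈ T} :=
    measurableSet_preimage (by fun_prop) hT
  have h := (measurePreserving_cond_preimage (hρ.measurePreserving_flip j) hB).integral_comp
    (flipIsometry j).toHomeomorph.measurableEmbedding (fun z => z j)
  simp only [Set.preimage_ofPred_eq, flipIsometry_apply_of_ne hij, flipIsometry_apply_self,
    integral_neg] at h
  linarith

/- Chebyshev's trick: adding the integrand with `z i` and `z j` exchanged gives
`(z i ^ 2 - z j ^ 2) * (G (z i) - G (z j)) ≤ 0`. -/
theorem integral_sq_sub_sq_mul_nonpos (hρ : IsHyperoctahedral ρ) {G : ℝ → ℝ}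
    (hG : ∀ ⦃x y⦄, |x| ≤ |y| → G y ≤ G x)
    (hint : Integrable (fun z => (z i ^ 2 - z j ^ 2) * G (z i)) ρ) :
    ∫ z, (z i ^ 2 - z j ^ 2) * G (z i) ∂ρ ≤ 0 := by
  have hswap := hρ.measurePreserving_swap i j
  have integral_swap := hswap.integral_comp (swapIsometry i j).toHomeomorph.measurableEmbedding
    (fun z => (z i ^ 2 - z j ^ 2) * G (z i))
  have hint_swap := hswap.integrable_comp_of_integrable hint
  simp only [Function.comp_def, swapIsometry_apply, Equiv.swap_apply_left,
    Equiv.swap_apply_right] at integral_swap hint_swap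
  have sum_nonpos :
      ∫ z, ((z i ^ 2 - z j ^ 2) * G (z i) + (z j ^ 2 - z i ^ 2) * G (z j)) ∂ρ ≤ 0 := by
    refine integral_nonpos fun z => ?_
    have swap_eq : (z i ^ 2 - z j ^ 2) * G (z i) + (z j ^ 2 - z i ^ 2) * G (z j)
        = (z i ^ 2 - z j ^ 2) * (G (z i) - G (z j)) := by ring
    rw [swap_eq]
    rcases le_total |z i| |z j| with h | h
    · exact mul_nonpos_of_nonpos_of_nonneg (sub_nonpos.2 (sq_le_sq.2 h)) (sub_nonneg.2 (hG h))
    · exact mul_nonpos_of_nonneg_of_nonpos (sub_nonneg.2 (sq_le_sq.2 h)) (sub_nonpos.2 (hG h))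
  rw [integral_add hint hint_swap, integral_swap] at sum_nonpos
  linarith

theorem setIntegral_sq_sub_sq_nonpos (hρ : IsHyperoctahedral ρ) (hT : T.OrdConnected)
    (h0 : (0 : ℝ) ∈ T) (hij : i ≠ j) (hint : Integrable (fun z => z i ^ 2 - z j ^ 2) ρ) :
    ∫ z in {z | z i ∈ T}, (z i ^ 2 - z j ^ 2) ∂ρ ≤ 0 := by
  have hB : MeasurableSet {z : EuclideanSpace ℝ ι | z i ∈ T} :=
    measurableSet_preimage (by fun_prop) hT.measurableSet
  set g : ℝ → ℝ := T.indicator 1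
  have indicator_eq : {z : EuclideanSpace ℝ ι | z i ∈ T}.indicator (fun z => z i ^ 2 - z j ^ 2)
      = fun z => (z i ^ 2 - z j ^ 2) * g (z i) := by
    ext z
    by_cases hz : z i ∈ T <;> simp [g, hz]
  have hint_g : Integrable (fun z => (z i ^ 2 - z j ^ 2) * g (z i)) ρ :=
    indicator_eq ▸ hint.indicator hB
  have hflip := hρ.measurePreserving_flip i
  have integral_flip := hflip.integral_comp (flipIsometry i).toHomeomorph.measurableEmbedding
    (fun z => (z i ^ 2 - z j ^ 2) * g (z i))
  have hint_flip := hflip.integrable_comp_of_integrable hint_g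
  simp only [Function.comp_def, flipIsometry_apply_self, flipIsometry_apply_of_ne hij.symm,
    neg_sq] at integral_flip hint_flip
  have symmetrized_nonpos := hρ.integral_sq_sub_sq_mul_nonpos (i := i) (j := j)
    (G := fun x => g x + g (-x)) (fun _ _ => indicator_add_indicator_neg_le hT h0)
    (by simpa only [mul_add] using! hint_g.add hint_flip)
  simp only [mul_add] at symmetrized_nonpos
  rw [integral_add hint_g hint_flip, integral_flip] at symmetrized_nonpos
  rw [← integral_indicator hB, indicator_eq]
  linarith

variable [IsFiniteMeasure ρ]

theorem variance_cond_le_of_zero_mem (hρ : IsHyperoctahedral ρ)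
    (hL2 : MemLp id 2 ρ) (hT : T.OrdConnected) (h0 : (0 : ℝ) ∈ T) (hij : i ≠ j) :
    Var[fun z => z i; ρ[|{z | z i ∈ T}]] ≤ Var[fun z => z j; ρ[|{z | z i ∈ T}]] := by
  by_cases hnull : ρ {z | z i ∈ T} = 0
  · simp [cond_eq_zero_of_meas_eq_zero hnull]
  have := cond_isProbabilityMeasure hnull
  have hsq : ∀ k, Integrable (fun z : EuclideanSpace ℝ ι => z k ^ 2) ρ :=
    fun k => (hL2.eval_piLp k).integrable_sq
  calc Var[fun z => z i; ρ[|{z | z i ∈ T}]]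
      ≤ ∫ z, z i ^ 2 ∂(ρ[|{z | z i ∈ T}]) := variance_le_expectation_sq (by fun_prop)
    _ ≤ ∫ z, z j ^ 2 ∂(ρ[|{z | z i ∈ T}]) := by
      have h := hρ.setIntegral_sq_sub_sq_nonpos hT h0 hij ((hsq i).sub (hsq j))
      rw [integral_sub (hsq i).integrableOn (hsq j).integrableOn, sub_nonpos] at h
      simp only [ProbabilityTheory.cond, integral_smul_measure]
      exact smul_le_smul_of_nonneg_left h ENNReal.toReal_nonneg
    _ = Var[fun z => z j; ρ[|{z | z i ∈ T}]] := (variance_of_integral_eq_zero (by fun_prop)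
      (hρ.integral_cond_eq_zero hT.measurableSet hij)).symm

theorem variance_cond_le (hρ : IsHyperoctahedral ρ) (hL2 : MemLp id 2 ρ) (hT : T.OrdConnected)
    (h0 : (0 : ℝ) ∈ T ∨ T.Subsingleton) (hij : i ≠ j) :
    Var[fun z => z i; ρ[|{z | z i ∈ T}]] ≤ Var[fun z => z j; ρ[|{z | z i ∈ T}]] := by
  rcases h0 with h0 | hsub
  · exact hρ.variance_cond_le_of_zero_mem hL2 hT h0 hij
  · exact (variance_cond_preimage_eq_zero (by fun_prop) hsub).trans_le (variance_nonneg _ _)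

theorem sum_mul_variance_cond_le (hρ : IsHyperoctahedral ρ) (hL2 : MemLp id 2 ρ)
    (hT : T.OrdConnected) (h0 : (0 : ℝ) ∈ T ∨ T.Subsingleton) {a : ι → ℝ} (ha : a i ≤ a j) :
    ∑ k, a k * Var[fun z => z k; ρ[|{z | z j ∈ T}]]
      ≤ ∑ k, a k * Var[fun z => z k; ρ[|{z | z i ∈ T}]] := by
  rcases eq_or_ne i j with rfl | hij
  · rfl
  simp_rw [← hρ.variance_cond_swap hT.measurableSet i j]
  exact sum_mul_le_sum_mul_swap (w := fun k => Var[fun z => z k; ρ[|{z | z i ∈ T}]]) ha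
    (hρ.variance_cond_le hL2 hT h0 hij)

end IsHyperoctahedral

end Hyperoctahedral

section CoordinatewiseAffine

variable {Ω : Type*} [MeasurableSpace Ω] {P : Measure Ω} {d : ℕ}
  {Y Z : Ω → EuclideanSpace ℝ (Fin d)} {s c : Fin d → ℝ}

theorem measurableSet_peelEvent (hY : Measurable Y) (α : ℝ) (i : Fin d) :
    MeasurableSet (peelEvent Y P α i) :=
  measurableSet_preimage (by fun_prop) (measurableSet_centralInterval _ _)

variable [IsProbabilityMeasure P]

theorem ofReal_one_sub_le_measure_peelEvent {i : Fin d}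
    (hYi : AEMeasurable (fun ω => Y ω i) P) {α : ℝ} (hα : 0 ≤ α) :
    ENNReal.ofReal (1 - α) ≤ P (peelEvent Y P α i) := by
  have := Measure.isProbabilityMeasure_map hYi
  have h := ofReal_one_sub_le_measure_centralInterval (P.map fun ω => Y ω i) hα
  rwa [Measure.map_apply_of_aemeasurable hYi (measurableSet_centralInterval _ _)] at h

theorem peelEvent_eq_preimage (hZ : AEMeasurable Z P) {s c : ℝ} (hs : 0 < s) {i : Fin d}
    (hY : ∀ ω, Y ω i = s * Z ω i + c) (α : ℝ) :
    peelEvent Y P α i = Z ⁻¹' peelEvent id (P.map Z) α i := by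
  have hZi : AEMeasurable (fun ω => Z ω i) P := by fun_prop
  have := Measure.isProbabilityMeasure_map hZi
  have map_Z : (P.map Z).map (fun z => z i) = P.map fun ω => Z ω i :=
    AEMeasurable.map_map_of_aemeasurable (by fun_prop) hZ
  have map_Y : P.map (fun ω => s * Z ω i + c) = (P.map fun ω => Z ω i).map fun x => s * x + c :=
    (AEMeasurable.map_map_of_aemeasurable (g := fun x => s * x + c) (by fun_prop) hZi).symm
  ext ω
  simp only [peelEvent, id_eq, Set.mem_preimage, Set.mem_ofPred_eq, map_Z, map_Y, hY,
    mul_add_mem_centralInterval_map_iff hs]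

theorem preservedTotalVariance_eq_sum (hZ : AEMeasurable Z P) (hs : ∀ k, 0 < s k)
    (hY : ∀ ω k, Y ω k = s k * Z ω k + c k) (α : ℝ) (i : Fin d) :
    preservedTotalVariance Y P α i
      = ∑ k, s k ^ 2 * Var[fun z => z k; (P.map Z)[|peelEvent id (P.map Z) α i]] := by
  have := Measure.isProbabilityMeasure_map hZ
  have hE := measurableSet_peelEvent (P := P.map Z) measurable_id α i
  rw [preservedTotalVariance, peelEvent_eq_preimage hZ (hs i) (fun ω => hY ω i),
    ← map_cond_preimage hZ hE]
  set Q := P[|Z ⁻¹' peelEvent id (P.map Z) α i]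
  have hZQ : AEMeasurable Z Q := hZ.mono_ac (cond_absolutelyContinuous)
  refine Finset.sum_congr rfl fun k _ => ?_
  have hZk : AEMeasurable (fun ω => Z ω k) Q := by fun_prop
  simp only [Matrix.diag_apply, covMatrix, Matrix.of_apply, hY]
  rw [covariance_self (by fun_prop), variance_map (by fun_prop) hZQ, ← variance_const_mul]
  rcases eq_zero_or_isProbabilityMeasure Q with h | h
  · simp [h]
  · exact variance_add_const (by fun_prop) _

theorem preservedTotalVariance_le (hZ : MemLp Z 2 P) (hsymm : IsHyperoctahedral (P.map Z))
    (hs : ∀ k, 0 < s k) (hY : ∀ ω k, Y ω k = s k * Z ω k + c k) (α : ℝ) {i j : Fin d}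
    (hij : s i ≤ s j) : preservedTotalVariance Y P α j ≤ preservedTotalVariance Y P α i := by
  have hZm := hZ.aestronglyMeasurable.aemeasurable
  have := Measure.isProbabilityMeasure_map hZm
  have hci : AEMeasurable (fun z : EuclideanSpace ℝ (Fin d) => z i) (P.map Z) := by fun_prop
  have := Measure.isProbabilityMeasure_map hci
  have hL2 : MemLp id 2 (P.map Z) := (memLp_map_measure_iff (by fun_prop) hZm).2 hZ
  rw [preservedTotalVariance_eq_sum hZm hs hY, preservedTotalVariance_eq_sum hZm hs hY]
  simp only [peelEvent, id_eq, hsymm.map_coord_eq j i]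
  exact hsymm.sum_mul_variance_cond_le hL2 (ordConnected_centralInterval _ α)
    (zero_mem_or_subsingleton_centralInterval (hsymm.map_neg_map_coord i) α)
    (pow_le_pow_left₀ (hs i).le hij 2)

end CoordinatewiseAffine

section CharacteristicFunction

theorem measurePreserving_of_charFun_eq_norm {E : Type*} [NormedAddCommGroup E]
    [InnerProductSpace ℝ E] [CompleteSpace E] [SecondCountableTopology E] [MeasurableSpace E]
    [BorelSpace E] {ρ : Measure E} [IsFiniteMeasure ρ] {ψ : ℝ → ℂ}
    (hψ : ∀ t, charFun ρ t = ψ ‖t‖) (U : E ≃ₗᵢ[ℝ] E) : MeasurePreserving U ρ ρ := by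
  have hU : Measurable U := U.continuous.measurable
  refine ⟨hU, Measure.ext_of_charFun (funext fun t => ?_)⟩
  have inner_apply_left : ∀ x, inner ℝ (U x) t = inner ℝ x (U.symm t) := fun x => by
    rw [← U.inner_map_map x (U.symm t), U.apply_symm_apply]
  calc charFun (ρ.map U) t
      = charFun ρ (U.symm t) := by
        rw [charFun_apply, charFun_apply, integral_map hU.aemeasurable
          (by fun_prop : Continuous _).aestronglyMeasurable]
        simp_rw [inner_apply_left]
    _ = charFun ρ t := by rw [hψ, hψ, U.symm.norm_map]

theorem isHyperoctahedral_of_charFun_eq_norm {ι : Type*} [Fintype ι] [DecidableEq ι]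
    {ρ : Measure (EuclideanSpace ℝ ι)} [IsFiniteMeasure ρ] {ψ : ℝ → ℂ}
    (hψ : ∀ t, charFun ρ t = ψ ‖t‖) : IsHyperoctahedral ρ where
  measurePreserving_swap _ _ := measurePreserving_of_charFun_eq_norm hψ _
  measurePreserving_flip _ := measurePreserving_of_charFun_eq_norm hψ _

end CharacteristicFunction

section Standardization

variable {ι E : Type*} [NormedAddCommGroup E] [InnerProductSpace ℝ E]

/-- The standardization `Λ^(-1/2) Vᵀ (x - m)` of a vector `x`, where `V` has columns `v k` and `Λ`
is the diagonal matrix with entries `lam k`. It turns principal components into uncorrelated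
coordinates of unit variance. -/
noncomputable def standardize (lam : ι → ℝ) (v : ι → E) (m x : E) : EuclideanSpace ℝ ι :=
  WithLp.toLp 2 fun k => inner ℝ (v k) (x - m) / √(lam k)

variable {lam : ι → ℝ} {v : ι → E} {m : E}

@[fun_prop]
theorem continuous_standardize : Continuous (standardize lam v m) := by
  unfold standardize
  fun_prop

variable [Fintype ι]

theorem inner_standardize (x : E) (t : EuclideanSpace ℝ ι) :
    inner ℝ (standardize lam v m x) t = inner ℝ (x - m) (∑ k, (t k / √(lam k)) • v k) := by
  simp only [standardize, PiLp.inner_apply, inner_sum, inner_smul_right, real_inner_comm (v _)]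
  refine Finset.sum_congr rfl fun k _ => ?_
  simp
  ring

theorem memLp_standardize {Ω : Type*} [MeasurableSpace Ω] {P : Measure Ω} [IsFiniteMeasure P]
    {X : Ω → E} {p : ENNReal} (hX : MemLp X p P) :
    MemLp (fun ω => standardize lam v m (X ω)) p P := by
  refine MemLp.of_eval_piLp fun k => ?_
  simp only [standardize, div_eq_mul_inv]
  exact ((hX.sub (memLp_const m)).const_inner (v k)).mul_const _

theorem charFun_map_standardize {Ω : Type*} [MeasurableSpace Ω] {P : Measure Ω}
    [MeasurableSpace E] [BorelSpace E] [SecondCountableTopology E] {X : Ω → E}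
    (hX : AEMeasurable X P) (t : EuclideanSpace ℝ ι) :
    charFun (P.map fun ω => standardize lam v m (X ω)) t
      = Complex.exp (-Complex.I * (inner ℝ (∑ k, (t k / √(lam k)) • v k) m : ℝ))
        * charFun (P.map X) (∑ k, (t k / √(lam k)) • v k) := by
  have hZ : AEMeasurable (fun ω => standardize lam v m (X ω)) P :=
    continuous_standardize.measurable.comp_aemeasurable hX
  rw [charFun_apply, charFun_apply,
    integral_map hZ (by fun_prop : Continuous _).aestronglyMeasurable,
    integral_map hX (by fun_prop : Continuous _).aestronglyMeasurable, ← integral_const_mul]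
  refine integral_congr_ae (.of_forall fun ω => ?_)
  simp only [inner_standardize, inner_sub_left, real_inner_comm _ m, ← Complex.exp_add]
  push_cast
  ring_nf

end Standardization

section Spectral

variable {ι κ : Type*} [Fintype ι] [Fintype κ] {S : Matrix ι ι ℝ}

theorem eigenvalue_pos_of_posDef (hS : S.PosDef) {x : ι → ℝ} (hx : x ≠ 0) {r : ℝ}
    (heig : S *ᵥ x = r • x) : 0 < r := by
  have h := hS.dotProduct_mulVec_pos hx
  rw [heig, dotProduct_smul, smul_eq_mul] at h
  exact pos_of_mul_pos_left h (dotProduct_star_self_nonneg x)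

theorem dotProduct_mulVec_sum_eigenvectors {v : κ → EuclideanSpace ℝ ι} (hv : Orthonormal ℝ v)
    {lam : κ → ℝ} (heig : ∀ k, S *ᵥ (v k).ofLp = lam k • (v k).ofLp) (a : κ → ℝ) :
    (∑ k, a k • v k).ofLp ⬝ᵥ (S *ᵥ (∑ k, a k • v k).ofLp) = ∑ k, lam k * a k ^ 2 := by
  have mulVec_eq : S *ᵥ (∑ k, a k • v k).ofLp = (∑ k, (a k * lam k) • v k).ofLp := by
    simp only [WithLp.ofLp_sum, WithLp.ofLp_smul, Matrix.mulVec_sum, Matrix.mulVec_smul, heig,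
      smul_smul]
  have dotProduct_eq_inner : ∀ x y : EuclideanSpace ℝ ι, x.ofLp ⬝ᵥ y.ofLp = inner ℝ y x :=
    fun x y => by rw [EuclideanSpace.inner_eq_star_dotProduct, star_trivial]
  rw [mulVec_eq, dotProduct_eq_inner, hv.inner_sum]
  exact Finset.sum_congr rfl fun k _ => by simp; ring

end Spectral

section Elliptical

variable {Ω : Type*} {d : ℕ} {X : Ω → EuclideanSpace ℝ (Fin d)} {m : EuclideanSpace ℝ (Fin d)}
  {S : Matrix (Fin d) (Fin d) ℝ} {lam : Fin d → ℝ} {v : Fin d → EuclideanSpace ℝ (Fin d)}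

theorem rotate_apply (v : Fin d → EuclideanSpace ℝ (Fin d)) (X : Ω → EuclideanSpace ℝ (Fin d))
    (ω : Ω) (k : Fin d) : rotate v X ω k = inner ℝ (v k) (X ω) := by
  simp [rotate, columnMatrix, Matrix.mulVec, dotProduct, PiLp.inner_apply, mul_comm]

theorem rotate_apply_eq_standardize {k : Fin d} (hk : 0 < lam k) (ω : Ω) :
    rotate v X ω k = √(lam k) * standardize lam v m (X ω) k + inner ℝ (v k) m := by
  have := (Real.sqrt_pos.2 hk).ne'
  simp only [rotate_apply, standardize, inner_sub_right]
  field_simp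
  ring

variable [MeasurableSpace Ω] {P : Measure Ω}

namespace IsElliptical

theorem eigenvalue_pos (hX : IsElliptical X P m S) (hv : Orthonormal ℝ v)
    (heig : ∀ i, S *ᵥ (v i).ofLp = lam i • (v i).ofLp) (i : Fin d) : 0 < lam i :=
  eigenvalue_pos_of_posDef hX.posDef (fun h => hv.ne_zero i ((WithLp.ofLp_eq_zero 2).1 h)) (heig i)

theorem isHyperoctahedral_map_standardize [IsProbabilityMeasure P] (hX : IsElliptical X P m S)
    (hv : Orthonormal ℝ v) (heig : ∀ i, S *ᵥ (v i).ofLp = lam i • (v i).ofLp) :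
    IsHyperoctahedral (P.map fun ω => standardize lam v m (X ω)) := by
  obtain ⟨φ, hφ⟩ := hX.charFun_eq
  refine isHyperoctahedral_of_charFun_eq_norm (ψ := fun r => φ (r ^ 2)) fun t => ?_
  have quadratic_form_eq : ∑ k, lam k * (t k / √(lam k)) ^ 2 = ‖t‖ ^ 2 := by
    rw [EuclideanSpace.real_norm_sq_eq]
    refine Finset.sum_congr rfl fun k _ => ?_
    have hk := hX.eigenvalue_pos hv heig k
    rw [div_pow, Real.sq_sqrt hk.le, mul_div_cancel₀ _ hk.ne']
  rw [charFun_map_standardize hX.measurable.aemeasurable, hφ,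
    dotProduct_mulVec_sum_eigenvectors hv heig, quadratic_form_eq, ← mul_assoc,
    ← Complex.exp_add, neg_mul, neg_add_cancel, Complex.exp_zero, one_mul]

end IsElliptical

end Elliptical

end Peeling

theorem mainTheorem5_general {Ω : Type*} [MeasurableSpace Ω] (P : Measure Ω)
    [IsProbabilityMeasure P] (d : ℕ) (hd : 0 < d) (Y Z : Ω → EuclideanSpace ℝ (Fin d))
    (hZ : MemLp Z 2 P) (hsymm : Peeling.IsHyperoctahedral (P.map Z))
    (s c : Fin d → ℝ) (hs : ∀ k, 0 < s k) (hanti : Antitone s)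
    (hY : ∀ ω k, Y ω k = s k * Z ω k + c k) (α : ℝ) (hα : α ∈ Set.Icc (0 : ℝ) 1) :
    (∀ i, ENNReal.ofReal (1 - α) ≤ P (Peeling.peelEvent Y P α i)) ∧
    (∀ i j, s i ≤ s j →
      Peeling.preservedTotalVariance Y P α j ≤ Peeling.preservedTotalVariance Y P α i) ∧
    (∀ i, Peeling.preservedTotalVariance Y P α i
        ≤ Peeling.preservedTotalVariance Y P α ⟨d - 1, Nat.sub_one_lt_of_lt hd⟩) ∧
    (∀ i, Peeling.preservedTotalVariance Y P α ⟨0, hd⟩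
        ≤ Peeling.preservedTotalVariance Y P α i) := by
  have hZm := hZ.aestronglyMeasurable.aemeasurable
  have hYm (k : Fin d) : AEMeasurable (fun ω => Y ω k) P := by
    simp_rw [hY]
    fun_prop
  have mono {i j : Fin d} (hij : s i ≤ s j) :
      Peeling.preservedTotalVariance Y P α j ≤ Peeling.preservedTotalVariance Y P α i :=
    Peeling.preservedTotalVariance_le hZ hsymm hs hY α hij
  exact ⟨fun i => Peeling.ofReal_one_sub_le_measure_peelEvent (hYm i) hα.1, fun _ _ => mono,
    fun i => mono (hanti (Fin.mk_le_mk.2 (by omega))),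
    fun i => mono (hanti (Fin.mk_le_mk.2 (Nat.zero_le _)))⟩

theorem mainTheorem5 {Ω : Type*} [MeasurableSpace Ω] (P : Measure Ω) [IsProbabilityMeasure P]
    (d : ℕ) (hd : 0 < d)
    (X : Ω → EuclideanSpace ℝ (Fin d)) (m : EuclideanSpace ℝ (Fin d))
    (S : Matrix (Fin d) (Fin d) ℝ) (hX : Peeling.IsElliptical X P m S)
    (lam : Fin d → ℝ) (hlam : Antitone lam)
    (v : Fin d → EuclideanSpace ℝ (Fin d)) (hv : Orthonormal ℝ v)
    (heig : ∀ i, S *ᵥ (v i).ofLp = lam i • (v i).ofLp)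
    (α : ℝ) (hα : α ∈ Set.Icc (0 : ℝ) 1) :
    (∀ i, ENNReal.ofReal (1 - α) ≤ P (Peeling.peelEvent (Peeling.rotate v X) P α i)) ∧
    (∀ i j, lam i ≤ lam j →
      Peeling.preservedTotalVariance (Peeling.rotate v X) P α j
        ≤ Peeling.preservedTotalVariance (Peeling.rotate v X) P α i) ∧
    (∀ i, Peeling.preservedTotalVariance (Peeling.rotate v X) P α i
        ≤ Peeling.preservedTotalVariance (Peeling.rotate v X) P α ⟨d - 1, by omega⟩) ∧
    (∀ i, Peeling.preservedTotalVariance (Peeling.rotate v X) P α ⟨0, hd⟩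
        ≤ Peeling.preservedTotalVariance (Peeling.rotate v X) P α i) := by
  obtain ⟨coverage, mono, extremal⟩ := mainTheorem5_general P d hd (Peeling.rotate v X) _
    (Peeling.memLp_standardize hX.memLp) (hX.isHyperoctahedral_map_standardize hv heig)
    (fun k => √(lam k)) (fun k => inner ℝ (v k) m)
    (fun k => Real.sqrt_pos.2 (hX.eigenvalue_pos hv heig k))
    (fun i j hij => Real.sqrt_le_sqrt (hlam hij))
    (fun ω k => Peeling.rotate_apply_eq_standardize (hX.eigenvalue_pos hv heig k) ω) α hα
  exact ⟨coverage, fun i j hij => mono i j (Real.sqrt_le_sqrt hij), extremal⟩
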